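/- Let $n\ge 2$, $K\ge 1$, and let $\Omega,\Omega'\subset\mathbb R^n$ be domains (non-empty, open, connected). Let $\phi:\Omega\to\Omega'$ be a $K$-quasiconformal mapping, that is, a homeomorphism of $\Omega$ onto $\Omega'$ such that $\phi\in W^{1,1}_{loc}(\Omega;\mathbb R^n)$ and its distributional derivative $D\phi$ satisfies $$|D\phi(x)|^n\le K\,|J_\phi(x)|\qquad\text{for a.e. }x\in\Omega,$$ where $J_\phi=\det D\phi$ and $|D\phi(x)|$ is the operator norm of $D\phi(x)$ with respect to the Euclidean norm. Let $b>0$ and $C_b$ be real numbers such that $$\left(\int_\Omega |J_\phi(x)|^{-b}\,dx\right)^{1/b}\le C_b$$ (with $0^{-b}=\infty$). Let $0<p\le\infty$ and let $q\in(0,\infty]$ be defined by $\frac1q=\frac1p+\frac1b\cdot\frac1p$, where $\frac1\infty=0$. Then for every $f\in L^p(\Omega')$ (real valued) the composition $f\circ\phi$ belongs to $L^q(\Omega)$ and $$\|f\circ\phi\|_{L^q(\Omega)}\le C_b^{1/p}\,\|f\|_{L^p(\Omega')}.$$ Here $\|g\|_{L^r}=\left(\int|g|^r\right)^{1/r}$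 for $0<r<\infty$, and $\|g\|_{L^\infty}$ is the essential supremum of $|g|$. -/

import Mathlib

open MeasureTheory Set
open scoped ENNReal ContDiff

/-- `D` is a weak (distributional) derivative of `φ` on the open set `Ω`, both being locally
integrable on `Ω`: for every test function `η ∈ C_c^∞(Ω)` and every direction `v`,
`∫_Ω (∂_v η) φ = - ∫_Ω η (D v)`. -/
structure HasWeakFDerivOn {n : ℕ}
    (φ : EuclideanSpace ℝ (Fin n) → EuclideanSpace ℝ (Fin n))
    (D : EuclideanSpace ℝ (Fin n) → EuclideanSpace ℝ (Fin n) →L[ℝ] EuclideanSpace ℝ (Fin n))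
    (Ω : Set (EuclideanSpace ℝ (Fin n))) : Prop where
  locallyIntegrableOn : LocallyIntegrableOn φ Ω volume
  locallyIntegrableOn_deriv : LocallyIntegrableOn D Ω volume
  integral_eq : ∀ η : EuclideanSpace ℝ (Fin n) → ℝ,
    ContDiff ℝ ∞ η → HasCompactSupport η → tsupport η ⊆ Ω →
    ∀ v : EuclideanSpace ℝ (Fin n),
      ∫ x in Ω, (fderiv ℝ η x v) • φ x = - ∫ x in Ω, η x • D x v

/-- `φ` belongs to the local Sobolev space `W^{1,1}_loc(Ω; ℝⁿ)`. -/
def MemW11loc {n : ℕ} (φ : EuclideanSpace ℝ (Fin n) → EuclideanSpace ℝ (Fin n))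
    (Ω : Set (EuclideanSpace ℝ (Fin n))) : Prop :=
  ∃ D, HasWeakFDerivOn φ D Ω

open Classical in
/-- The distributional derivative `Dφ` on `Ω` of a map `φ ∈ W^{1,1}_loc(Ω; ℝⁿ)` (a representative:
it is unique up to a null subset of `Ω`), and `0` for other maps. -/
noncomputable def weakFDeriv {n : ℕ}
    (φ : EuclideanSpace ℝ (Fin n) → EuclideanSpace ℝ (Fin n))
    (Ω : Set (EuclideanSpace ℝ (Fin n))) :
    EuclideanSpace ℝ (Fin n) → EuclideanSpace ℝ (Fin n) →L[ℝ] EuclideanSpace ℝ (Fin n) :=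
  if h : MemW11loc φ Ω then h.choose else 0

theorem MemW11loc.hasWeakFDerivOn {n : ℕ}
    {φ : EuclideanSpace ℝ (Fin n) → EuclideanSpace ℝ (Fin n)}
    {Ω : Set (EuclideanSpace ℝ (Fin n))} (h : MemW11loc φ Ω) :
    HasWeakFDerivOn φ (weakFDeriv φ Ω) Ω := by
  rw [weakFDeriv, dif_pos h]
  exact h.choose_spec

/-- The Jacobian determinant `J_φ = det Dφ` of `φ` on `Ω`. -/
noncomputable def weakJacobian {n : ℕ}
    (φ : EuclideanSpace ℝ (Fin n) → EuclideanSpace ℝ (Fin n))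
    (Ω : Set (EuclideanSpace ℝ (Fin n))) (x : EuclideanSpace ℝ (Fin n)) : ℝ :=
  (weakFDeriv φ Ω x).det

/-- A domain of `ℝⁿ`: a non-empty connected open set. -/
structure IsEuclideanDomain {n : ℕ} (Ω : Set (EuclideanSpace ℝ (Fin n))) : Prop where
  isOpen : IsOpen Ω
  isConnected : IsConnected Ω

/-- `φ : Ω → Ω'` is a `K`-quasiconformal mapping (only the values of `φ` on `Ω` matter): a
homeomorphism of `Ω` onto `Ω'` in `W^{1,1}_loc(Ω)` with `|Dφ|ⁿ ≤ K |J_φ|` almost everywhere,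
where `|·|` is the operator norm. -/
structure IsQuasiconformal {n : ℕ} (K : ℝ)
    (φ : EuclideanSpace ℝ (Fin n) → EuclideanSpace ℝ (Fin n))
    (Ω Ω' : Set (EuclideanSpace ℝ (Fin n))) : Prop where
  homeomorph : ∃ e : OpenPartialHomeomorph (EuclideanSpace ℝ (Fin n)) (EuclideanSpace ℝ (Fin n)),
    e.source = Ω ∧ e.target = Ω' ∧ EqOn φ e Ω
  memW11loc : MemW11loc φ Ω
  distortion : ∀ᵐ x ∂(volume.restrict Ω), ‖weakFDeriv φ Ω x‖ ^ n ≤ K * |weakJacobian φ Ω x|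

section Mollifier

open Metric Module

set_option linter.unusedSectionVars false

variable {E : Type*} [NormedAddCommGroup E] [NormedSpace ℝ E] [FiniteDimensional ℝ E]
  [MeasurableSpace E] [BorelSpace E]

/-- The smooth bump with support the open unit ball, normalized to have integral one. -/
noncomputable def unitMollifier (μ : Measure E) : E → ℝ :=
  ContDiffBump.normed (⟨1 / 2, 1, by norm_num, by norm_num⟩ : ContDiffBump (0 : E)) μ

/-- The rescaled mollifier `s⁻ⁿ ρ(z / s)`. -/
noncomputable def mollifier (μ : Measure E) (s : ℝ) (z : E) : ℝ :=
  (s ^ finrank ℝ E)⁻¹ * unitMollifier μ (s⁻¹ • z)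

variable (μ : Measure E)

theorem contDiff_unitMollifier : ContDiff ℝ ∞ (unitMollifier μ) :=
  ContDiffBump.contDiff_normed _

theorem unitMollifier_nonneg (z : E) : 0 ≤ unitMollifier μ z := ContDiffBump.nonneg_normed _ _

theorem mollifier_nonneg {s : ℝ} (hs : 0 ≤ s) (z : E) : 0 ≤ mollifier μ s z :=
  mul_nonneg (by positivity) (unitMollifier_nonneg μ _)

theorem mollifier_neg (s : ℝ) (z : E) : mollifier μ s (-z) = mollifier μ s z := by
  simp only [mollifier, smul_neg, unitMollifier, ContDiffBump.normed_neg]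

theorem contDiff_mollifier (s : ℝ) : ContDiff ℝ ∞ (mollifier μ s) :=
  contDiff_const.mul ((contDiff_unitMollifier μ).comp (contDiff_const_smul _))

theorem contDiffOn_mollifier :
    ContDiffOn ℝ ∞ (↿(mollifier μ)) (Ioi (0 : ℝ) ×ˢ (univ : Set E)) := by
  have h0 : ∀ p ∈ Ioi (0 : ℝ) ×ˢ (univ : Set E), p.1 ≠ 0 := fun p hp => (ne_of_gt hp.1)
  have h1 : ContDiffOn ℝ ∞ (fun p : ℝ × E => (p.1 ^ finrank ℝ E)⁻¹)
      (Ioi (0 : ℝ) ×ˢ (univ : Set E)) :=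
    (contDiff_fst.pow _).contDiffOn.inv fun p hp => pow_ne_zero _ (h0 p hp)
  have h2 : ContDiffOn ℝ ∞ (fun p : ℝ × E => p.1⁻¹ • p.2) (Ioi (0 : ℝ) ×ˢ (univ : Set E)) :=
    (contDiff_fst.contDiffOn.inv h0).smul contDiff_snd.contDiffOn
  exact h1.mul ((contDiff_unitMollifier μ).comp_contDiffOn h2)

theorem fderiv_mollifier (s : ℝ) (z v : E) :
    fderiv ℝ (mollifier μ s) z v =
      (s ^ finrank ℝ E)⁻¹ * fderiv ℝ (unitMollifier μ) (s⁻¹ • z) (s⁻¹ • v) := by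
  have h1 : HasFDerivAt (unitMollifier μ) (fderiv ℝ (unitMollifier μ) (s⁻¹ • z)) (s⁻¹ • z) :=
    ((contDiff_unitMollifier μ).differentiable (by simp) _).hasFDerivAt
  have h2 : HasFDerivAt (fun z : E => s⁻¹ • z) (s⁻¹ • ContinuousLinearMap.id ℝ E) z :=
    (hasFDerivAt_id z).const_smul _
  have h3 := (h1.comp z h2).const_mul ((s ^ finrank ℝ E)⁻¹)
  have h4 : HasFDerivAt (mollifier μ s) _ z := h3
  rw [h4.fderiv]
  simp

theorem fderiv_uncurry_mollifier {s : ℝ} (hs : 0 < s) (z : E) (σ : ℝ) (v : E) :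
    fderiv ℝ (↿(mollifier μ)) (s, z) (σ, v) =
      fderiv ℝ (mollifier μ s) z (v - (σ / s) • z) -
        (finrank ℝ E : ℝ) * (σ / s) * mollifier μ s z := by
  have h1 : HasFDerivAt (unitMollifier μ) (fderiv ℝ (unitMollifier μ) (s⁻¹ • z)) (s⁻¹ • z) :=
    ((contDiff_unitMollifier μ).differentiable (by simp) _).hasFDerivAt
  have hz : HasDerivAt (fun t : ℝ => z + t • v) v 0 := by
    simpa using ((hasDerivAt_id (0 : ℝ)).smul_const v).const_add z
  have hs' : HasDerivAt (fun t : ℝ => s + t * σ) σ 0 := by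
    simpa using ((hasDerivAt_id (0 : ℝ)).mul_const σ).const_add s
  have hinv : HasDerivAt (fun t : ℝ => (s + t * σ)⁻¹) (-σ / s ^ 2) 0 := by
    have h := hs'.inv (by simpa using hs.ne')
    rwa [zero_mul, add_zero] at h
  have hpow : HasDerivAt (fun t : ℝ => ((s + t * σ)⁻¹) ^ finrank ℝ E)
      (finrank ℝ E * (s⁻¹) ^ (finrank ℝ E - 1) * (-σ / s ^ 2)) 0 := by
    have h := hinv.pow (finrank ℝ E)
    rwa [zero_mul, add_zero] at h
  have hsm : HasDerivAt (fun t : ℝ => (s + t * σ)⁻¹ • (z + t • v))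
      (s⁻¹ • v + (-σ / s ^ 2) • z) 0 := by
    have h := hinv.smul hz
    rwa [zero_mul, add_zero, zero_smul, add_zero] at h
  have hρ : HasDerivAt (fun t : ℝ => unitMollifier μ ((s + t * σ)⁻¹ • (z + t • v)))
      (fderiv ℝ (unitMollifier μ) (s⁻¹ • z) (s⁻¹ • v + (-σ / s ^ 2) • z)) 0 := by
    have h1' : HasFDerivAt (unitMollifier μ) (fderiv ℝ (unitMollifier μ) (s⁻¹ • z))
      ((s + 0 * σ)⁻¹ • (z + (0 : ℝ) • v)) := by simpa using h1
    exact h1'.comp_hasDerivAt (0 : ℝ) hsm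
  have hprod := hpow.mul hρ
  have hd : DifferentiableAt ℝ (↿(mollifier μ)) (s, z) :=
    ((contDiffOn_mollifier μ).contDiffAt
      ((isOpen_Ioi.prod isOpen_univ).mem_nhds ⟨mem_Ioi.2 hs, mem_univ _⟩)).differentiableAt (by simp)
  have hline : HasDerivAt (fun t : ℝ => (s + t * σ, z + t • v)) (σ, v) 0 := hs'.prodMk hz
  have hd' : HasFDerivAt (↿(mollifier μ)) (fderiv ℝ (↿(mollifier μ)) (s, z))
      (s + 0 * σ, z + (0 : ℝ) • v) := by simpa using hd.hasFDerivAt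
  have hcomp := hd'.comp_hasDerivAt (0 : ℝ) hline
  have heq : (↿(mollifier μ) ∘ fun t : ℝ => (s + t * σ, z + t • v)) =
      (fun t : ℝ => ((s + t * σ)⁻¹) ^ finrank ℝ E) *
        (fun t : ℝ => unitMollifier μ ((s + t * σ)⁻¹ • (z + t • v))) := by
    ext t
    simp [Function.HasUncurry.uncurry, mollifier, inv_pow]
  rw [heq] at hcomp
  rw [hcomp.unique hprod, fderiv_mollifier, mollifier]
  have e1 : s⁻¹ • (v - (σ / s) • z) = s⁻¹ • v + (-σ / s ^ 2) • z := by
    rw [smul_sub, smul_smul, sub_eq_add_neg, ← neg_smul]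
    congr 2
    field_simp
  rw [e1]
  have e2 : (finrank ℝ E : ℝ) * s⁻¹ ^ (finrank ℝ E - 1) * (-σ / s ^ 2) =
      -((finrank ℝ E : ℝ) * (σ / s)) * (s ^ finrank ℝ E)⁻¹ := by
    rcases Nat.eq_zero_or_pos (finrank ℝ E) with h | h
    · simp [h]
    · obtain ⟨m, hm⟩ := Nat.exists_eq_succ_of_ne_zero h.ne'
      rw [hm]
      simp only [Nat.succ_eq_add_one, Nat.add_sub_cancel, inv_pow]
      field_simp
      ring
  simp only [zero_mul, add_zero, zero_smul]
  rw [e2, inv_pow]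
  ring

variable [μ.IsAddHaarMeasure]

theorem unitMollifier_eq_zero {z : E} (hz : 1 ≤ ‖z‖) : unitMollifier μ z = 0 := by
  have h := ContDiffBump.support_normed_eq
    (⟨1 / 2, 1, by norm_num, by norm_num⟩ : ContDiffBump (0 : E)) (μ := μ)
  by_contra hne
  have : z ∈ Function.support (unitMollifier μ) := hne
  rw [unitMollifier, h] at this
  simp at this
  linarith

theorem mollifier_eq_zero {s : ℝ} (hs : 0 < s) {z : E} (hz : s ≤ ‖z‖) : mollifier μ s z = 0 := by
  rw [mollifier, unitMollifier_eq_zero, mul_zero]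
  rw [norm_smul, norm_inv, Real.norm_of_nonneg hs.le]
  field_simp
  exact hz

theorem exists_unitMollifier_le : ∃ C : ℝ, 0 < C ∧ ∀ z, unitMollifier μ z ≤ C := by
  have hc : HasCompactSupport (unitMollifier μ) := ContDiffBump.hasCompactSupport_normed _
  obtain ⟨C, hC⟩ := hc.exists_bound_of_continuous (contDiff_unitMollifier μ).continuous
  exact ⟨max C 1, by positivity, fun z => (Real.le_norm_self _).trans ((hC z).trans (le_max_left _ _))⟩

theorem integral_mollifier {s : ℝ} (hs : 0 < s) : ∫ z, mollifier μ s z ∂μ = 1 := by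
  simp only [mollifier]
  rw [integral_const_mul, Measure.integral_comp_inv_smul_of_nonneg μ _ hs.le, unitMollifier,
    ContDiffBump.integral_normed, smul_eq_mul, mul_one, inv_mul_cancel₀ (by positivity)]

theorem hasCompactSupport_mollifier {s : ℝ} (hs : 0 < s) : HasCompactSupport (mollifier μ s) :=
  HasCompactSupport.intro (isCompact_closedBall 0 s) fun z hz => by
    refine mollifier_eq_zero μ hs ?_
    simp at hz
    exact hz.le

theorem integrable_mollifier {s : ℝ} (hs : 0 < s) : Integrable (mollifier μ s) μ :=
  (contDiff_mollifier μ s).continuous.integrable_of_hasCompactSupport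
    (hasCompactSupport_mollifier μ hs)

end Mollifier

section Mollification

open Metric Module

set_option linter.unusedSectionVars false

variable {E : Type*} [NormedAddCommGroup E] [NormedSpace ℝ E] [FiniteDimensional ℝ E]
  [MeasurableSpace E] [BorelSpace E]
  {F : Type*} [NormedAddCommGroup F] [NormedSpace ℝ F]
  {μ : Measure E} {u : E → F} {G : E → E →L[ℝ] F} {U : Set E}

/-- The identity `∫ (∂_v η) u = - ∫ η (G v)` for test functions `η` supported in `U`. -/
def WeakFDerivIdentity (μ : Measure E) (u : E → F) (G : E → E →L[ℝ] F) (U : Set E) : Prop :=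
  ∀ η : E → ℝ, ContDiff ℝ ∞ η → HasCompactSupport η → tsupport η ⊆ U →
    ∀ v : E, ∫ x, fderiv ℝ η x v • u x ∂μ = -∫ x, η x • G x v ∂μ

theorem WeakFDerivIdentity.integral_trace_fderiv_smul (h : WeakFDerivIdentity μ u G U)
    (hu : LocallyIntegrable u μ) (hG : LocallyIntegrable G μ) {X : E → E}
    (hX : ContDiff ℝ ∞ X) (hXc : HasCompactSupport X) (hXU : tsupport X ⊆ U) :
    ∫ y, LinearMap.trace ℝ E (fderiv ℝ X y) • u y ∂μ = -∫ y, G y (X y) ∂μ := by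
  let b := Module.finBasis ℝ E
  let c : Fin (finrank ℝ E) → E →L[ℝ] ℝ := fun i => LinearMap.toContinuousLinearMap (b.coord i)
  have hη : ∀ i, ContDiff ℝ ∞ (fun y => c i (X y)) := fun i => (c i).contDiff.comp hX
  have hηc : ∀ i, HasCompactSupport (fun y => c i (X y)) := fun i =>
    hXc.comp_left (g := c i) (map_zero _)
  have hηU : ∀ i, tsupport (fun y => c i (X y)) ⊆ U := fun i =>
    (closure_mono (Function.support_comp_subset (map_zero (c i)) X)).trans hXU
  have hfd : ∀ i y v, fderiv ℝ (fun y => c i (X y)) y v = c i (fderiv ℝ X y v) := by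
    intro i y v
    have h1 : HasFDerivAt X (fderiv ℝ X y) y := (hX.differentiable (by simp) y).hasFDerivAt
    have h2 := (c i).hasFDerivAt.comp y h1
    have h3 : HasFDerivAt (fun y => c i (X y)) _ y := h2
    rw [h3.fderiv]
    rfl
  have htr : ∀ T : E →L[ℝ] E, LinearMap.trace ℝ E T = ∑ i, c i (T (b i)) := by
    intro T
    rw [LinearMap.trace_eq_matrix_trace ℝ b]
    simp [Matrix.trace, LinearMap.toMatrix_apply, c]
  have hsum : ∀ y, X y = ∑ i, c i (X y) • b i := fun y => (b.sum_repr (X y)).symm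
  have hI1 : ∀ i, Integrable (fun y => fderiv ℝ (fun y => c i (X y)) y (b i) • u y) μ := by
    intro i
    refine hu.integrable_smul_left_of_hasCompactSupport ?_ ?_
    · exact ((hη i).continuous_fderiv (by simp)).clm_apply continuous_const
    · exact (hηc i).fderiv_apply ℝ (b i)
  have hI2 : ∀ i, Integrable (fun y => c i (X y) • G y (b i)) μ := by
    intro i
    refine LocallyIntegrable.integrable_smul_left_of_hasCompactSupport (f := fun y => G y (b i))
      ?_ (hη i).continuous (hηc i)
    exact fun x => (hG x).imp fun s hs => ⟨hs.1, hs.2.apply_continuousLinearMap (b i)⟩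
  calc ∫ y, LinearMap.trace ℝ E (fderiv ℝ X y) • u y ∂μ
      = ∫ y, ∑ i, fderiv ℝ (fun y => c i (X y)) y (b i) • u y ∂μ := by
        congr 1
        ext y
        rw [htr, Finset.sum_smul]
        simp only [hfd]
    _ = ∑ i, ∫ y, fderiv ℝ (fun y => c i (X y)) y (b i) • u y ∂μ :=
        integral_finsetSum _ fun i _ => hI1 i
    _ = ∑ i, -∫ y, c i (X y) • G y (b i) ∂μ :=
        Finset.sum_congr rfl fun i _ => h _ (hη i) (hηc i) (hηU i) (b i)
    _ = -∫ y, ∑ i, c i (X y) • G y (b i) ∂μ := by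
        rw [Finset.sum_neg_distrib, integral_finsetSum _ fun i _ => hI2 i]
    _ = -∫ y, G y (X y) ∂μ := by
        congr 2
        ext y
        conv_rhs => rw [hsum y]
        simp

variable [μ.IsAddHaarMeasure]

variable (μ u) in
/-- The mollification of `u` at scale `s`. -/
noncomputable def mollification (s : ℝ) (w : E) : F := ∫ y, mollifier μ s (w - y) • u y ∂μ

theorem hasFDerivAt_mollification (hu : LocallyIntegrable u μ) {s : ℝ} (hs : 0 < s) (w : E) :
    ∃ T : ℝ × E →L[ℝ] F, HasFDerivAt (fun p : ℝ × E => mollification μ u p.1 p.2) T (s, w) ∧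
      ∀ p, T p = ∫ y, fderiv ℝ (↿(mollifier μ)) (s, w - y) p • u y ∂μ := by
  have h := hasFDerivAt_convolution_right_with_param (𝕜 := ℝ) (μ := μ) (f := u)
    (ContinuousLinearMap.lsmul ℝ ℝ : ℝ →L[ℝ] F →L[ℝ] F).flip (g := mollifier μ)
    (s := Ioo 0 (s + 1)) (k := closedBall (0 : E) (s + 1)) isOpen_Ioo (isCompact_closedBall _ _)
    (fun p x hp hx => mollifier_eq_zero μ hp.1 (by simp at hx; linarith [hp.2])) hu
    (((contDiffOn_mollifier μ).of_le (by simp)).mono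
      (prod_mono (fun x hx => hx.1) subset_rfl)) (s, w) ⟨hs, by simp⟩
  refine ⟨_, h, fun p => ?_⟩
  have hex : ConvolutionExistsAt u (fun x => fderiv ℝ (↿(mollifier μ)) (s, x)) w
      (ContinuousLinearMap.precompR (ℝ × E)
        (ContinuousLinearMap.lsmul ℝ ℝ : ℝ →L[ℝ] F →L[ℝ] F).flip) μ := by
    refine HasCompactSupport.convolutionExists_right _ ?_ hu ?_ w
    · refine HasCompactSupport.intro (isCompact_closedBall 0 s) fun z hz => ?_
      have hz' : s < ‖z‖ := by simpa using hz
      have hev : (↿(mollifier μ) : ℝ × E → ℝ) =ᶠ[nhds (s, z)] fun _ => 0 := by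
        have h1 : ∀ᶠ p : ℝ × E in nhds (s, z), 0 < p.1 :=
          continuous_fst.continuousAt.eventually (lt_mem_nhds hs)
        have h2 : ∀ᶠ p : ℝ × E in nhds (s, z), p.1 < ‖p.2‖ :=
          continuous_fst.continuousAt.eventually_lt continuous_snd.norm.continuousAt hz'
        filter_upwards [h1, h2] with p hp1 hp2
        exact mollifier_eq_zero μ hp1 hp2.le
      rw [hev.fderiv_eq]
      simp
    · have hc : ContinuousOn (fderiv ℝ (↿(mollifier μ))) (Ioi (0 : ℝ) ×ˢ (univ : Set E)) :=
        (contDiffOn_mollifier μ).continuousOn_fderiv_of_isOpen (isOpen_Ioi.prod isOpen_univ)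
          (by simp)
      exact hc.comp_continuous (by fun_prop) fun x => ⟨hs, mem_univ _⟩
  rw [convolution, ContinuousLinearMap.integral_apply hex]
  rfl

/-- The derivative of the mollification, jointly in the scale and the point, in terms of the weak
derivative. -/
theorem WeakFDerivIdentity.hasFDerivAt_mollification (h : WeakFDerivIdentity μ u G U)
    (hu : LocallyIntegrable u μ) (hG : LocallyIntegrable G μ) {s : ℝ} (hs : 0 < s) {w : E}
    (hU : closedBall w s ⊆ U) :
    ∃ T : ℝ × E →L[ℝ] F, HasFDerivAt (fun p : ℝ × E => mollification μ u p.1 p.2) T (s, w) ∧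
      ∀ (σ : ℝ) (v : E),
        T (σ, v) = ∫ y, mollifier μ s (w - y) • G y (v - (σ / s) • (w - y)) ∂μ := by
  obtain ⟨T, hT, hTe⟩ := _root_.hasFDerivAt_mollification hu hs w
  refine ⟨T, hT, fun σ v => ?_⟩
  set X : E → E := fun y => mollifier μ s (w - y) • (v - (σ / s) • (w - y)) with hXdef
  have hX : ContDiff ℝ ∞ X := by
    refine ((contDiff_mollifier μ s).comp (contDiff_const.sub contDiff_id)).smul ?_
    exact contDiff_const.sub ((contDiff_const.sub contDiff_id).const_smul _)
  have hXs : Function.support X ⊆ closedBall w s := by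
    intro y hy
    by_contra hne
    refine hy ?_
    rw [mem_closedBall, not_le, dist_comm, dist_eq_norm] at hne
    simp [X, mollifier_eq_zero μ hs hne.le]
  have hXt : tsupport X ⊆ closedBall w s := closure_minimal hXs isClosed_closedBall
  have hXc : HasCompactSupport X := HasCompactSupport.of_support_subset_isCompact
    (isCompact_closedBall w s) hXs
  have hdiv := h.integral_trace_fderiv_smul hu hG hX hXc (hXt.trans hU)
  have htr : ∀ y, LinearMap.trace ℝ E (fderiv ℝ X y) =
      -fderiv ℝ (↿(mollifier μ)) (s, w - y) (σ, v) := by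
    intro y
    have h1 : HasFDerivAt (fun y : E => w - y) (-ContinuousLinearMap.id ℝ E) y :=
      (hasFDerivAt_id y).const_sub w
    have h2 : HasFDerivAt (mollifier μ s) (fderiv ℝ (mollifier μ s) (w - y)) (w - y) :=
      ((contDiff_mollifier μ s).differentiable (by simp) _).hasFDerivAt
    have h3 := (h2.comp y h1).smul ((h1.const_smul (σ / s)).const_sub v)
    have h4 : HasFDerivAt X _ y := h3
    rw [h4.fderiv, fderiv_uncurry_mollifier μ hs]
    have e : ((mollifier μ s ∘ fun y => w - y) y • -((σ / s) • -ContinuousLinearMap.id ℝ E) +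
        ContinuousLinearMap.smulRight ((fderiv ℝ (mollifier μ s) (w - y)).comp
          (-ContinuousLinearMap.id ℝ E)) (v - (σ / s) • (w - y)) : E →L[ℝ] E).toLinearMap =
        (mollifier μ s (w - y) * (σ / s)) • LinearMap.id +
          LinearMap.smulRight (-(fderiv ℝ (mollifier μ s) (w - y)).toLinearMap)
            (v - (σ / s) • (w - y)) := by
      ext z
      simp [smul_smul]
    have e' := congrArg (LinearMap.trace ℝ E) e
    refine e'.trans ?_
    rw [map_add, map_smul, LinearMap.trace_id, LinearMap.trace_smulRight]
    simp only [LinearMap.neg_apply, ContinuousLinearMap.coe_coe, smul_eq_mul]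
    ring
  rw [hTe]
  simp only [htr, neg_smul, integral_neg, neg_inj] at hdiv
  rw [hdiv]
  simp [X]

end Mollification

section PointwiseEstimates

open Metric Module Filter Topology

set_option linter.unusedSectionVars false

variable {E : Type*} [NormedAddCommGroup E] [NormedSpace ℝ E] [FiniteDimensional ℝ E]
  [MeasurableSpace E] [BorelSpace E]
  {F : Type*} [NormedAddCommGroup F] [NormedSpace ℝ F] [CompleteSpace F]
  {μ : Measure E} [μ.IsAddHaarMeasure] {u : E → F} {G : E → E →L[ℝ] F} {U : Set E}

theorem integral_mollifier_sub {s : ℝ} (hs : 0 < s) (w : E) :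
    ∫ y, mollifier μ s (w - y) ∂μ = 1 := by
  rw [integral_sub_left_eq_self (fun z => mollifier μ s z) μ w, integral_mollifier μ hs]

theorem integrable_mollifier_sub_smul {s : ℝ} (hs : 0 < s) (w : E)
    (hu : LocallyIntegrable u μ) : Integrable (fun y => mollifier μ s (w - y) • u y) μ := by
  refine hu.integrable_smul_left_of_hasCompactSupport (g := fun y => mollifier μ s (w - y))
    ((contDiff_mollifier μ s).continuous.comp (by fun_prop)) ?_
  refine HasCompactSupport.intro (isCompact_closedBall w s) fun z hz => ?_
  rw [mem_closedBall, not_le, dist_comm, dist_eq_norm] at hz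
  exact mollifier_eq_zero μ hs hz.le

theorem integral_mollifier_smul_affine {s : ℝ} (hs : 0 < s) (w v : E) (c : ℝ) :
    ∫ y, mollifier μ s (w - y) • (v - c • (w - y)) ∂μ = v := by
  rw [integral_sub_left_eq_self (fun z => mollifier μ s z • (v - c • z)) μ w]
  have hodd : ∫ z, mollifier μ s z • z ∂μ = 0 := by
    have h := integral_neg_eq_self (fun z => mollifier μ s z • z) μ
    simp only [mollifier_neg, smul_neg, integral_neg] at h
    have h2 : (2 : ℝ) • ∫ z, mollifier μ s z • z ∂μ = 0 := by
      rw [two_smul]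
      nth_rewrite 1 [← h]
      simp
    simpa using h2
  have hi : Integrable (fun z => mollifier μ s z • z) μ :=
    ((contDiff_mollifier μ s).continuous.smul continuous_id).integrable_of_hasCompactSupport
      (hasCompactSupport_mollifier μ hs).smul_right
  have e : (fun z => mollifier μ s z • (v - c • z)) =
      fun z => mollifier μ s z • v - c • (mollifier μ s z • z) := by
    ext z
    rw [smul_sub, smul_comm]
  have hi2 : Integrable (fun z => c • mollifier μ s z • z) μ := hi.smul c
  rw [e, integral_sub ((integrable_mollifier μ hs).smul_const v) hi2, integral_smul, hodd, integral_smul_const, integral_mollifier μ hs]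
  simp

/-- The derivative of the mollification differs from `G x` by at most a mean oscillation. -/
theorem WeakFDerivIdentity.exists_hasFDerivAt_mollification (h : WeakFDerivIdentity μ u G U)
    (hu : LocallyIntegrable u μ) (hG : LocallyIntegrable G μ) {C : ℝ}
    (hC : ∀ z, unitMollifier μ z ≤ C) {s R : ℝ} (hs : 0 < s) {w x : E}
    (hU : closedBall w s ⊆ U) (hR : closedBall w s ⊆ closedBall x R) :
    ∃ T : ℝ × E →L[ℝ] F, HasFDerivAt (fun p : ℝ × E => mollification μ u p.1 p.2) T (s, w) ∧
      ∀ (σ : ℝ) (v : E), ‖T (σ, v) - G x v‖ ≤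
        (C * (s ^ finrank ℝ E)⁻¹ * ∫ y in closedBall x R, ‖G y - G x‖ ∂μ) * (‖v‖ + |σ|) := by
  obtain ⟨T, hT, hTe⟩ := h.hasFDerivAt_mollification hu hG hs hU
  refine ⟨T, hT, fun σ v => ?_⟩
  have hsupp : ∀ (H : E → E →L[ℝ] F), LocallyIntegrable H μ →
      Integrable (fun y => mollifier μ s (w - y) • H y (v - (σ / s) • (w - y))) μ := by
    intro H hH
    have hm : Integrable (fun y => mollifier μ s (w - y) • H y) μ :=
      integrable_mollifier_sub_smul hs w hH
    refine (hm.norm.mul_const (‖v‖ + |σ|)).mono' ?_ (Eventually.of_forall fun y => ?_)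
    · exact isBoundedBilinearMap_apply.continuous.comp_aestronglyMeasurable
        (hm.aestronglyMeasurable.prodMk (by fun_prop : Continuous fun y : E =>
          v - (σ / s) • (w - y)).aestronglyMeasurable)
    · by_cases hy : s ≤ ‖w - y‖
      · rw [mollifier_eq_zero μ hs hy]
        simp
      · rw [← smul_apply]
        refine (ContinuousLinearMap.le_opNorm _ _).trans ?_
        gcongr
        refine (norm_sub_le _ _).trans ?_
        gcongr
        rw [norm_smul, norm_div, Real.norm_eq_abs, Real.norm_of_nonneg hs.le, div_mul_eq_mul_div,
          div_le_iff₀ hs]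
        gcongr
        exact (not_le.1 hy).le
  have hcl : LocallyIntegrable (fun _ : E => G x) μ := locallyIntegrable_const _
  have e1 : G x v = ∫ y, mollifier μ s (w - y) • G x (v - (σ / s) • (w - y)) ∂μ := by
    have hi : Integrable (fun y => mollifier μ s (w - y) • (v - (σ / s) • (w - y))) μ :=
      integrable_mollifier_sub_smul hs w
        (by fun_prop : Continuous fun y : E => v - (σ / s) • (w - y)).locallyIntegrable
    conv_lhs => rw [← integral_mollifier_smul_affine (μ := μ) hs w v (σ / s)]
    rw [← (G x).integral_comp_comm hi]
    simp only [map_smul]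
  rw [hTe, e1, ← integral_sub (hsupp G hG) (hsupp _ hcl)]
  have hGi : IntegrableOn (fun y => ‖G y - G x‖) (closedBall x R) μ :=
    ((hG.sub hcl).integrableOn_isCompact (isCompact_closedBall x R)).norm
  have hle : ∀ y, ‖mollifier μ s (w - y) • G y (v - (σ / s) • (w - y)) -
      mollifier μ s (w - y) • G x (v - (σ / s) • (w - y))‖ ≤
      (closedBall x R).indicator
        (fun y => C * (s ^ finrank ℝ E)⁻¹ * (‖v‖ + |σ|) * ‖G y - G x‖) y := by
    intro y
    by_cases hy : s < ‖w - y‖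
    · rw [mollifier_eq_zero μ hs hy.le]
      simp only [zero_smul, sub_zero, norm_zero]
      refine indicator_nonneg (fun y _ => ?_) y
      have hC0 : 0 ≤ C := (unitMollifier_nonneg μ 0).trans (hC 0)
      positivity
    · have hy' := not_lt.1 hy
      have hmem : y ∈ closedBall x R := hR (by rwa [mem_closedBall, dist_comm, dist_eq_norm])
      rw [indicator_of_mem hmem, ← smul_sub, ← sub_apply, norm_smul,
        Real.norm_of_nonneg (mollifier_nonneg μ hs.le _)]
      have hm : mollifier μ s (w - y) ≤ C * (s ^ finrank ℝ E)⁻¹ := by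
        rw [mollifier, mul_comm]
        gcongr
        exact hC _
      have hv : ‖v - (σ / s) • (w - y)‖ ≤ ‖v‖ + |σ| := by
        refine (norm_sub_le _ _).trans ?_
        gcongr
        rw [norm_smul, norm_div, Real.norm_eq_abs, Real.norm_of_nonneg hs.le, div_mul_eq_mul_div,
          div_le_iff₀ hs]
        gcongr
      calc mollifier μ s (w - y) * ‖(G y - G x) (v - (σ / s) • (w - y))‖
          ≤ C * (s ^ finrank ℝ E)⁻¹ * (‖G y - G x‖ * (‖v‖ + |σ|)) :=
            mul_le_mul hm (((G y - G x).le_opNorm _).trans (by gcongr)) (norm_nonneg _)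
              ((mollifier_nonneg μ hs.le _).trans hm)
        _ = _ := by ring
  refine (norm_integral_le_of_norm_le ?_ (Eventually.of_forall hle)).trans_eq ?_
  · exact (integrable_indicator_iff measurableSet_closedBall).2 (hGi.const_mul _)
  · rw [integral_indicator measurableSet_closedBall, integral_const_mul]
    ring

theorem tendsto_mollification (hu : LocallyIntegrable u μ) {x : E} (hc : ContinuousAt u x) :
    Tendsto (fun s => mollification μ u s x) (𝓝[>] 0) (𝓝 (u x)) := by
  rw [Metric.tendsto_nhds]
  intro ε hε
  obtain ⟨δ, hδ, hd⟩ := Metric.continuousAt_iff.1 hc (ε / 2) (by positivity)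
  filter_upwards [Ioo_mem_nhdsGT hδ] with s hs
  have e1 : u x = ∫ y, mollifier μ s (x - y) • u x ∂μ := by
    rw [integral_smul_const, integral_mollifier_sub hs.1, one_smul]
  rw [dist_eq_norm, mollification]
  conv_lhs => rw [e1]
  rw [← integral_sub (integrable_mollifier_sub_smul hs.1 x hu)
    (integrable_mollifier_sub_smul hs.1 x (locallyIntegrable_const _))]
  have hi : Integrable (fun y => mollifier μ s (x - y) * (ε / 2)) μ :=
    ((integrable_mollifier μ hs.1).comp_sub_left x).mul_const _
  refine (norm_integral_le_of_norm_le hi (Eventually.of_forall fun y => ?_)).trans_lt ?_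
  · rw [← smul_sub, norm_smul, Real.norm_of_nonneg (mollifier_nonneg μ hs.1.le _)]
    by_cases hy : s ≤ ‖x - y‖
    · rw [mollifier_eq_zero μ hs.1 hy]
      simp
    · gcongr
      · exact mollifier_nonneg μ hs.1.le _
      · rw [← dist_eq_norm]
        refine (hd ?_).le
        rw [dist_comm, dist_eq_norm]
        linarith [hs.2]
  · rw [integral_mul_const, integral_mollifier_sub hs.1]
    linarith

theorem WeakFDerivIdentity.norm_mollification_sub_le (h : WeakFDerivIdentity μ u G U)
    (hu : LocallyIntegrable u μ) (hG : LocallyIntegrable G μ) {C : ℝ}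
    (hC : ∀ z, unitMollifier μ z ≤ C) {x : E} (hc : ContinuousAt u x) {r ε : ℝ} (hr : 0 < r)
    (hU : closedBall x r ⊆ U)
    (hosc : ∀ s ∈ Ioc 0 r, ∫ y in closedBall x s, ‖G y - G x‖ ∂μ ≤ ε * s ^ finrank ℝ E) :
    ‖mollification μ u r x - u x‖ ≤ C * ε * r := by
  have hC0 : 0 ≤ C := (unitMollifier_nonneg μ 0).trans (hC 0)
  have hder : ∀ s ∈ Ioc 0 r, ∃ d : F, HasDerivAt (fun s => mollification μ u s x) d s ∧
      ‖d‖ ≤ C * ε := by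
    intro s hs
    obtain ⟨T, hT, hTle⟩ := h.exists_hasFDerivAt_mollification hu hG hC hs.1 (w := x) (x := x)
      (R := s) ((closedBall_subset_closedBall hs.2).trans hU) subset_rfl
    refine ⟨T (1, 0), ?_, ?_⟩
    · exact hT.comp_hasDerivAt s ((hasDerivAt_id s).prodMk (hasDerivAt_const s x))
    · have h1 := hTle 1 0
      rw [map_zero, sub_zero, norm_zero, abs_one, zero_add, mul_one] at h1
      refine h1.trans ?_
      have hpos : 0 < s ^ finrank ℝ E := pow_pos hs.1 _
      calc C * (s ^ finrank ℝ E)⁻¹ * ∫ y in closedBall x s, ‖G y - G x‖ ∂μ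
          ≤ C * (s ^ finrank ℝ E)⁻¹ * (ε * s ^ finrank ℝ E) := by
            gcongr
            exact hosc s hs
        _ = C * ε := by field_simp
  choose! d hd hdle using hder
  have hmv : ∀ δ ∈ Ioc 0 r, ‖mollification μ u r x - mollification μ u δ x‖ ≤ C * ε * r := by
    intro δ hδ
    have := (convex_Ioc 0 r).norm_image_sub_le_of_norm_hasDerivWithin_le
      (fun s hs => (hd s hs).hasDerivWithinAt) hdle hδ ⟨hr, le_rfl⟩
    refine this.trans ?_
    have hCε : 0 ≤ C * ε := (norm_nonneg _).trans (hdle r ⟨hr, le_rfl⟩)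
    gcongr
    rw [Real.norm_of_nonneg (by linarith [hδ.2])]
    linarith [hδ.1]
  refine le_of_tendsto ((tendsto_mollification hu hc).const_sub _).norm ?_
  filter_upwards [Ioc_mem_nhdsGT hr] with δ hδ using hmv δ hδ

/-- First order Taylor estimate between two points near which `G` has small mean oscillation. -/
theorem WeakFDerivIdentity.norm_sub_sub_le (h : WeakFDerivIdentity μ u G U)
    (hu : LocallyIntegrable u μ) (hG : LocallyIntegrable G μ) {C : ℝ}
    (hC : ∀ z, unitMollifier μ z ≤ C) {x y : E} (hx : ContinuousAt u x) (hy : ContinuousAt u y)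
    {r ε : ℝ} (hr : 0 < r) (hxy : ‖y - x‖ = r)
    (hU : closedBall x (2 * r) ⊆ U)
    (hox : ∀ s ∈ Ioc 0 (2 * r),
      ∫ y in closedBall x s, ‖G y - G x‖ ∂μ ≤ ε * s ^ finrank ℝ E)
    (hoy : ∀ s ∈ Ioc 0 r,
      ∫ z in closedBall y s, ‖G z - G y‖ ∂μ ≤ ε * s ^ finrank ℝ E) :
    ‖u y - u x - G x (y - x)‖ ≤ (2 + 2 ^ finrank ℝ E) * C * ε * ‖y - x‖ := by
  have hC0 : 0 ≤ C := (unitMollifier_nonneg μ 0).trans (hC 0)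
  have hb : ∀ w ∈ closedBall x r, closedBall w r ⊆ closedBall x (2 * r) := by
    intro w hw
    refine closedBall_subset_closedBall' ?_
    rw [mem_closedBall] at hw
    linarith
  have hyx : y ∈ closedBall x r := by rw [mem_closedBall, dist_eq_norm, hxy]
  have h1 := h.norm_mollification_sub_le hu hG hC hx hr
    ((closedBall_subset_closedBall (by linarith)).trans hU)
    (fun s hs => hox s ⟨hs.1, by linarith [hs.2]⟩)
  have h2 := h.norm_mollification_sub_le hu hG hC hy hr ((hb y hyx).trans hU) hoy
  have hder : ∀ w ∈ closedBall x r, ∃ D : E →L[ℝ] F,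
      HasFDerivAt (fun w => mollification μ u r w) D w ∧
        ‖D - G x‖ ≤ 2 ^ finrank ℝ E * C * ε := by
    intro w hw
    obtain ⟨T, hT, hTle⟩ := h.exists_hasFDerivAt_mollification hu hG hC hr (w := w) (x := x)
      (R := 2 * r) ((hb w hw).trans hU) (hb w hw)
    have hle : C * (r ^ finrank ℝ E)⁻¹ * ∫ y in closedBall x (2 * r), ‖G y - G x‖ ∂μ ≤
        2 ^ finrank ℝ E * C * ε := by
      have hpos : 0 < r ^ finrank ℝ E := pow_pos hr _
      calc C * (r ^ finrank ℝ E)⁻¹ * ∫ y in closedBall x (2 * r), ‖G y - G x‖ ∂μ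
          ≤ C * (r ^ finrank ℝ E)⁻¹ * (ε * (2 * r) ^ finrank ℝ E) := by
            gcongr
            exact hox _ ⟨by linarith, le_rfl⟩
        _ = _ := by rw [mul_pow]; field_simp
    refine ⟨T.comp (ContinuousLinearMap.inr ℝ ℝ E), ?_, ?_⟩
    · have h3 : HasFDerivAt (fun w : E => (r, w)) (ContinuousLinearMap.inr ℝ ℝ E) w :=
        hasFDerivAt_prodMk_right r w
      exact hT.comp w h3
    · refine ContinuousLinearMap.opNorm_le_bound _ ?_ fun v => ?_
      · refine le_trans ?_ hle
        have : 0 ≤ ∫ y in closedBall x (2 * r), ‖G y - G x‖ ∂μ :=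
          integral_nonneg fun _ => norm_nonneg _
        positivity
      · have h4 := hTle 0 v
        rw [abs_zero, add_zero] at h4
        exact h4.trans (by gcongr)
  choose! D hD hDle using hder
  have h3 := Convex.norm_image_sub_le_of_norm_hasFDerivWithin_le'
    (fun w hw => (hD w hw).hasFDerivWithinAt) hDle (convex_closedBall x r)
    (mem_closedBall_self hr.le) hyx
  have e : u y - u x - G x (y - x) = (mollification μ u r x - u x) -
      (mollification μ u r y - u y) +
      (mollification μ u r y - mollification μ u r x - G x (y - x)) := by abel
  rw [e]
  refine (norm_add_le _ _).trans ((add_le_add (norm_sub_le _ _) le_rfl).trans ?_)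
  rw [hxy] at h3 ⊢
  linarith

end PointwiseEstimates

section Decomposition

open Metric Module Filter Topology

set_option linter.unusedSectionVars false

variable {E : Type*} [NormedAddCommGroup E] [NormedSpace ℝ E] [FiniteDimensional ℝ E]
  [MeasurableSpace E] [BorelSpace E]
  {F : Type*} [NormedAddCommGroup F] [NormedSpace ℝ F] [CompleteSpace F]
  {μ : Measure E} [μ.IsAddHaarMeasure] {u : E → F} {G : E → E →L[ℝ] F} {U : Set E}

/-- At the points of `A`, the mean oscillation of `G` over small balls tends to zero uniformly. -/
def UniformlySmallOscillation (μ : Measure E) (G : E → E →L[ℝ] F) (A : Set E) : Prop :=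
  ∀ ε > 0, ∃ δ > 0, ∀ x ∈ A, ∀ s ∈ Ioc 0 δ,
    ∫ y in closedBall x s, ‖G y - G x‖ ∂μ ≤ ε * s ^ finrank ℝ E

/-- Egorov's theorem for the convergence of mean oscillations at Lebesgue points. -/
theorem exists_uniformlySmallOscillation (hG : LocallyIntegrable G μ) (hGm : StronglyMeasurable G)
    {B : Set E} (hB : MeasurableSet B) (hBf : μ B ≠ ⊤) {η : ℝ} (hη : 0 < η) :
    ∃ N ⊆ B, MeasurableSet N ∧ μ N ≤ ENNReal.ofReal η ∧
      UniformlySmallOscillation μ G (B \ N) := by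
  let ρ : ℕ → ℝ := fun k => (1 / 2) ^ k
  have hρ : ∀ k, 0 < ρ k := fun k => by positivity
  have hρt : Tendsto ρ atTop (𝓝[>] 0) := tendsto_nhdsWithin_iff.2
    ⟨tendsto_pow_atTop_nhds_zero_of_lt_one (by norm_num) (by norm_num),
      Eventually.of_forall fun k => hρ k⟩
  let f : ℕ → E → ℝ := fun k x =>
    (ρ k ^ finrank ℝ E)⁻¹ * ∫ y in closedBall x (ρ k), ‖G y - G x‖ ∂μ
  have hf : ∀ k, StronglyMeasurable (f k) := by
    intro k
    have h1 : StronglyMeasurable (fun p : E × E =>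
        {p : E × E | dist p.2 p.1 ≤ ρ k}.indicator (fun p => ‖G p.2 - G p.1‖) p) := by
      refine StronglyMeasurable.indicator ?_ ?_
      · exact ((hGm.comp_measurable measurable_snd).sub
          (hGm.comp_measurable measurable_fst)).norm
      · exact (isClosed_le (by fun_prop) (by fun_prop)).measurableSet
    have h2 := h1.integral_prod_right' (ν := μ)
    have h3 : f k = fun x => (ρ k ^ finrank ℝ E)⁻¹ *
        ∫ y, {p : E × E | dist p.2 p.1 ≤ ρ k}.indicator (fun p => ‖G p.2 - G p.1‖) (x, y) ∂μ := by
      ext x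
      simp only [f]
      rw [← integral_indicator measurableSet_closedBall]
      rfl
    rw [h3]
    exact h2.const_mul _
  have hlim : ∀ᵐ x ∂μ, x ∈ B → Tendsto (fun k => f k x) atTop (𝓝 0) := by
    filter_upwards [IsUnifLocDoublingMeasure.ae_tendsto_average_norm_sub μ hG 1] with x hx _
    have h1 := hx (fun _ : ℕ => x) ρ hρt
      (Eventually.of_forall fun k => mem_closedBall_self (by linarith [hρ k]))
    have h2 := h1.mul_const (μ.real (ball 0 1))
    rw [zero_mul] at h2
    refine h2.congr fun k => ?_
    have hpos : μ.real (ball (0 : E) 1) ≠ 0 := by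
      rw [measureReal_def, ENNReal.toReal_ne_zero]
      exact ⟨(measure_ball_pos μ _ one_pos).ne', measure_ball_lt_top.ne⟩
    rw [setAverage_eq, Measure.addHaar_real_closedBall μ _ (hρ k).le, smul_eq_mul, mul_inv]
    simp only [f]
    field_simp
  obtain ⟨N, hNB, hNm, hNη, hunif⟩ := tendstoUniformlyOn_of_ae_tendsto hf
    (stronglyMeasurable_const (b := (0 : ℝ))) hB hBf hlim hη
  refine ⟨N, hNB, hNm, hNη, fun ε hε => ?_⟩
  rw [Metric.tendstoUniformlyOn_iff] at hunif
  obtain ⟨k₀, hk₀⟩ := eventually_atTop.1 (hunif (ε / 2 ^ finrank ℝ E) (by positivity))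
  refine ⟨ρ k₀, hρ k₀, fun x hx s hs => ?_⟩
  obtain ⟨k, hk1, hk2⟩ := exists_nat_pow_near_of_lt_one hs.1
    (hs.2.trans (pow_le_one₀ (by norm_num) (by norm_num))) (y := (1 / 2 : ℝ)) (by norm_num)
    (by norm_num)
  have hk : k₀ ≤ k := by
    by_contra! hlt
    have : ρ k₀ ≤ (1 / 2 : ℝ) ^ (k + 1) :=
      pow_le_pow_of_le_one (by norm_num) (by norm_num) hlt
    linarith [hs.2]
  have h1 := hk₀ k hk x hx
  rw [dist_zero_left, Real.norm_eq_abs] at h1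
  have h2 := (le_abs_self _).trans h1.le
  have hint : ∫ y in closedBall x (ρ k), ‖G y - G x‖ ∂μ ≤
      ε / 2 ^ finrank ℝ E * ρ k ^ finrank ℝ E := by
    have hp := pow_pos (hρ k) (finrank ℝ E)
    simp only [f] at h2
    rwa [inv_mul_le_iff₀ hp, mul_comm] at h2
  have hmono : ∫ y in closedBall x s, ‖G y - G x‖ ∂μ ≤
      ∫ y in closedBall x (ρ k), ‖G y - G x‖ ∂μ := by
    refine setIntegral_mono_set ?_ (Eventually.of_forall fun _ => norm_nonneg _)
      (closedBall_subset_closedBall hk2).eventuallyLE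
    exact ((hG.sub (locallyIntegrable_const _)).integrableOn_isCompact
      (isCompact_closedBall x _)).norm
  refine hmono.trans (hint.trans ?_)
  have h3 : ρ k ≤ 2 * s := by
    rw [pow_succ] at hk1
    simp only [ρ]
    linarith
  calc ε / 2 ^ finrank ℝ E * ρ k ^ finrank ℝ E
      ≤ ε / 2 ^ finrank ℝ E * (2 * s) ^ finrank ℝ E := by
        gcongr
    _ = ε * s ^ finrank ℝ E := by
        rw [mul_pow]
        field_simp

theorem WeakFDerivIdentity.hasFDerivWithinAt (h : WeakFDerivIdentity μ u G U)
    (hu : LocallyIntegrable u μ) (hG : LocallyIntegrable G μ) (hU : IsOpen U)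
    (hc : ContinuousOn u U) {A : Set E} (hAU : A ⊆ U) (hA : UniformlySmallOscillation μ G A)
    {x : E} (hx : x ∈ A) : HasFDerivWithinAt u (G x) A x := by
  rw [hasFDerivWithinAt_iff_isLittleO, Asymptotics.isLittleO_iff]
  intro c hcpos
  obtain ⟨C, hC0, hC⟩ := exists_unitMollifier_le μ
  obtain ⟨δ, hδ, hosc⟩ := hA (c / ((2 + 2 ^ finrank ℝ E) * C)) (by positivity)
  obtain ⟨R, hR, hRU⟩ := Metric.isOpen_iff.1 hU x (hAU hx)
  filter_upwards [self_mem_nhdsWithin,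
    mem_nhdsWithin_of_mem_nhds (ball_mem_nhds x (half_pos (lt_min hδ hR)))] with y hyA hy
  rcases eq_or_ne y x with rfl | hne
  · simp
  have hr : 0 < ‖y - x‖ := norm_pos_iff.2 (sub_ne_zero.2 hne)
  rw [mem_ball, dist_eq_norm] at hy
  have hyδ : 2 * ‖y - x‖ ≤ δ := by linarith [min_le_left δ R]
  have hyR : 2 * ‖y - x‖ < R := by linarith [min_le_right δ R]
  have := h.norm_sub_sub_le hu hG hC (hc.continuousAt (hU.mem_nhds (hAU hx)))
    (hc.continuousAt (hU.mem_nhds (hAU hyA))) hr rfl ((closedBall_subset_ball hyR).trans hRU)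
    (fun s hs => hosc x hx s ⟨hs.1, hs.2.trans hyδ⟩)
    (fun s hs => hosc y hyA s ⟨hs.1, by linarith [hs.2]⟩)
  refine this.trans_eq ?_
  field_simp

/-- A continuous function with an integrable weak derivative is differentiable along countably
many measurable pieces which exhaust the domain up to a null set. -/
theorem WeakFDerivIdentity.exists_hasFDerivWithinAt (h : WeakFDerivIdentity μ u G U)
    (hu : LocallyIntegrable u μ) (hG : LocallyIntegrable G μ) (hU : IsOpen U) (hUf : μ U ≠ ⊤)
    (hc : ContinuousOn u U) :
    ∃ t : ℕ → Set E, (∀ k, MeasurableSet (t k)) ∧ (∀ k, t k ⊆ U) ∧ μ (U \ ⋃ k, t k) = 0 ∧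
      ∀ k, ∀ x ∈ t k, HasFDerivWithinAt u (G x) (t k) x := by
  obtain ⟨G', hG'm, hGG'⟩ := hG.aestronglyMeasurable
  have hG' : LocallyIntegrable G' μ := fun x =>
    (hG x).imp fun s hs => ⟨hs.1, hs.2.congr (ae_restrict_of_ae hGG')⟩
  have h' : WeakFDerivIdentity μ u G' U := by
    intro η h1 h2 h3 v
    rw [h η h1 h2 h3 v, neg_inj]
    refine integral_congr_ae ?_
    filter_upwards [hGG'] with x hx
    rw [hx]
  set Z := toMeasurable μ {x | G x ≠ G' x} with hZ
  have hZ0 : μ Z = 0 := by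
    rw [hZ, measure_toMeasurable]
    exact hGG'
  have hη : ∀ k : ℕ, (0 : ℝ) < 1 / (k + 1) := fun k => by positivity
  choose N hNU hNm hNη hosc using fun k =>
    exists_uniformlySmallOscillation hG' hG'm hU.measurableSet hUf (hη k)
  refine ⟨fun k => (U \ N k) \ Z, fun k => (hU.measurableSet.diff (hNm k)).diff
    (measurableSet_toMeasurable _ _), fun k => sdiff_subset.trans sdiff_subset, ?_, ?_⟩
  · have hsub : U \ ⋃ k, (U \ N k) \ Z ⊆ (⋂ k, N k) ∪ Z := by
      rintro x ⟨hxU, hx⟩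
      by_contra hne
      simp only [mem_union, mem_iInter, not_or, not_forall] at hne
      obtain ⟨⟨k, hk⟩, hxZ⟩ := hne
      exact hx (mem_iUnion.2 ⟨k, ⟨hxU, hk⟩, hxZ⟩)
    refine measure_mono_null hsub (measure_union_null ?_ hZ0)
    refine le_antisymm (ge_of_tendsto' (f := fun k : ℕ => ENNReal.ofReal (1 / ((k : ℝ) + 1)))
      (x := atTop) ?_ fun k => (measure_mono (iInter_subset _ k)).trans (hNη k)) zero_le
    simpa using ENNReal.tendsto_ofReal tendsto_one_div_add_atTop_nhds_zero_nat
  · intro k x hx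
    have hxG : G x = G' x := by
      by_contra hne
      exact hx.2 (subset_toMeasurable _ _ hne)
    rw [hxG]
    exact (h'.hasFDerivWithinAt hu hG' hU hc sdiff_subset (hosc k) hx.1).mono sdiff_subset

end Decomposition

section ChangeOfVariables

open Metric Filter Topology

variable {n : ℕ} {φ : EuclideanSpace ℝ (Fin n) → EuclideanSpace ℝ (Fin n)}
  {D : EuclideanSpace ℝ (Fin n) → EuclideanSpace ℝ (Fin n) →L[ℝ] EuclideanSpace ℝ (Fin n)}
  {Ω : Set (EuclideanSpace ℝ (Fin n))}

theorem MeasureTheory.LocallyIntegrableOn.locallyIntegrable_indicator {E F : Type*}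
    [TopologicalSpace E] [T2Space E] [MeasurableSpace E] [BorelSpace E] [NormedAddCommGroup F]
    {μ : Measure E} {f : E → F} {s Q : Set E} (hf : LocallyIntegrableOn f s μ) (hQ : IsCompact Q)
    (hQs : Q ⊆ s) : LocallyIntegrable (Q.indicator f) μ :=
  ((hf.integrableOn_compact_subset hQs hQ).integrable_indicator hQ.measurableSet).locallyIntegrable

theorem HasWeakFDerivOn.weakFDerivIdentity_indicator (h : HasWeakFDerivOn φ D Ω)
    {Q U : Set (EuclideanSpace ℝ (Fin n))} (hQΩ : Q ⊆ Ω) (hUQ : U ⊆ Q) :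
    WeakFDerivIdentity volume (Q.indicator φ) (Q.indicator D) U := by
  intro η hη hηc hηU v
  have hη0 : ∀ x ∉ Q, η x = 0 := fun x hx =>
    image_eq_zero_of_notMem_tsupport fun hx' => hx (hUQ (hηU hx'))
  have hηf : ∀ x ∉ Q, fderiv ℝ η x = 0 := fun x hx =>
    fderiv_of_notMem_tsupport ℝ fun hx' => hx (hUQ (hηU hx'))
  have h1 := h.integral_eq η hη hηc ((hηU.trans hUQ).trans hQΩ) v
  rw [setIntegral_eq_integral_of_forall_compl_eq_zero fun x hx => by
      simp [hηf x fun hxQ => hx (hQΩ hxQ)],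
    setIntegral_eq_integral_of_forall_compl_eq_zero fun x hx => by
      simp [hη0 x fun hxQ => hx (hQΩ hxQ)]] at h1
  have e1 : ∀ x, fderiv ℝ η x v • Q.indicator φ x = fderiv ℝ η x v • φ x := by
    intro x
    by_cases hx : x ∈ Q
    · rw [indicator_of_mem hx]
    · simp [hηf x hx]
  have e2 : ∀ x, η x • Q.indicator D x v = η x • D x v := by
    intro x
    by_cases hx : x ∈ Q
    · rw [indicator_of_mem hx]
    · simp [hη0 x hx]
  simp only [e1, e2]
  exact h1

theorem HasWeakFDerivOn.exists_hasFDerivWithinAt (h : HasWeakFDerivOn φ D Ω) (hΩ : IsOpen Ω)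
    (hc : ContinuousOn φ Ω) :
    ∃ t : ℕ → Set (EuclideanSpace ℝ (Fin n)), (∀ k, MeasurableSet (t k)) ∧ (∀ k, t k ⊆ Ω) ∧
      volume (Ω \ ⋃ k, t k) = 0 ∧ ∀ k, ∀ x ∈ t k, HasFDerivWithinAt φ (D x) (t k) x := by
  have hloc : ∀ x ∈ Ω, ∃ r > 0, ∃ t : ℕ → Set (EuclideanSpace ℝ (Fin n)),
      (∀ k, MeasurableSet (t k)) ∧ (∀ k, t k ⊆ Ω) ∧ volume (ball x r \ ⋃ k, t k) = 0 ∧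
        ∀ k, ∀ y ∈ t k, HasFDerivWithinAt φ (D y) (t k) y := by
    intro x hx
    obtain ⟨R, hR, hRΩ⟩ := Metric.nhds_basis_closedBall.mem_iff.1 (hΩ.mem_nhds hx)
    have hcp : IsCompact (closedBall x R) := isCompact_closedBall x R
    have hφi := h.locallyIntegrableOn.locallyIntegrable_indicator hcp hRΩ
    have hDi := LocallyIntegrableOn.locallyIntegrable_indicator
      (F := EuclideanSpace ℝ (Fin n) →L[ℝ] EuclideanSpace ℝ (Fin n))
      h.locallyIntegrableOn_deriv hcp hRΩ
    have hid := h.weakFDerivIdentity_indicator hRΩ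
      (ball_subset_closedBall : ball x R ⊆ closedBall x R)
    have heq : EqOn ((closedBall x R).indicator φ) φ (ball x R) := fun y hy =>
      indicator_of_mem (ball_subset_closedBall hy) φ
    obtain ⟨t, ht1, ht2, ht3, ht4⟩ := hid.exists_hasFDerivWithinAt hφi hDi isOpen_ball measure_ball_lt_top.ne
      ((hc.mono (ball_subset_closedBall.trans hRΩ)).congr heq)
    refine ⟨R, hR, t, ht1, fun k => (ht2 k).trans (ball_subset_closedBall.trans hRΩ), ht3, ?_⟩
    intro k y hy
    have hy' := ht4 k y hy
    rw [indicator_of_mem (ball_subset_closedBall (ht2 k hy))] at hy'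
    exact hy'.congr (fun z hz => (heq (ht2 k hz)).symm) (heq (ht2 k hy)).symm
  choose! r hr t ht1 ht2 ht3 ht4 using hloc
  obtain ⟨S, hSΩ, hSc, hcov⟩ := TopologicalSpace.countable_cover_nhdsWithin
    (f := fun x => ball x (r x)) (s := Ω)
    fun x hx => mem_nhdsWithin_of_mem_nhds (ball_mem_nhds x (hr x hx))
  rcases S.eq_empty_or_nonempty with hS | hS
  · have hΩe : Ω = ∅ := by simpa [hS] using hcov
    exact ⟨fun _ => ∅, by simp [hΩe]⟩
  obtain ⟨x, hx⟩ := hSc.exists_eq_range hS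
  have hxΩ : ∀ i, x i ∈ Ω := fun i => hSΩ (hx ▸ mem_range_self i)
  refine ⟨fun m => t (x m.unpair.1) m.unpair.2, fun m => ht1 _ (hxΩ _) _,
    fun m => ht2 _ (hxΩ _) _, ?_, fun m => ht4 _ (hxΩ _) _⟩
  refine measure_mono_null (t := ⋃ i, (ball (x i) (r (x i)) \ ⋃ k, t (x i) k)) ?_
    (measure_iUnion_null fun i => ht3 _ (hxΩ i))
  rintro y ⟨hyΩ, hy⟩
  have hy' := hcov hyΩ
  rw [hx, biUnion_range, mem_iUnion] at hy'
  obtain ⟨i, hi⟩ := hy'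
  refine mem_iUnion.2 ⟨i, hi, fun hyt => hy ?_⟩
  obtain ⟨k, hk⟩ := mem_iUnion.1 hyt
  exact mem_iUnion.2 ⟨Nat.pair i k, by simpa using hk⟩

/-- The change of variables inequality for injective continuous Sobolev maps. -/
theorem HasWeakFDerivOn.lintegral_abs_det_mul_comp_le (h : HasWeakFDerivOn φ D Ω)
    (hΩ : IsOpen Ω) (hc : ContinuousOn φ Ω) (hinj : InjOn φ Ω)
    {Ω' : Set (EuclideanSpace ℝ (Fin n))} (hmaps : MapsTo φ Ω Ω')
    (g : EuclideanSpace ℝ (Fin n) → ℝ≥0∞) :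
    ∫⁻ x in Ω, ENNReal.ofReal |(D x).det| * g (φ x) ≤ ∫⁻ y in Ω', g y := by
  obtain ⟨t, ht1, ht2, ht3, ht4⟩ := h.exists_hasFDerivWithinAt hΩ hc
  let s := disjointed t
  have hs1 : ∀ k, MeasurableSet (s k) := MeasurableSet.disjointed ht1
  have hst : ∀ k, s k ⊆ t k := disjointed_subset t
  have hsΩ : ∀ k, s k ⊆ Ω := fun k => (hst k).trans (ht2 k)
  have hsd : Pairwise (Function.onFun Disjoint s) := disjoint_disjointed t
  have hsU : ⋃ k, s k = ⋃ k, t k := iUnion_disjointed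
  have hae : (Ω : Set (EuclideanSpace ℝ (Fin n))) =ᵐ[volume] ⋃ k, s k := by
    rw [hsU]
    refine ae_eq_set.2 ⟨ht3, ?_⟩
    rw [sdiff_eq_empty.2 (iUnion_subset ht2)]
    exact measure_empty
  have hdisj : Pairwise (Function.onFun Disjoint fun k => φ '' s k) := fun i j hij =>
    (hsd hij).image hinj (hsΩ i) (hsΩ j)
  calc ∫⁻ x in Ω, ENNReal.ofReal |(D x).det| * g (φ x)
      = ∑' k, ∫⁻ x in s k, ENNReal.ofReal |(D x).det| * g (φ x) := by
        rw [setLIntegral_congr hae, lintegral_iUnion hs1 hsd]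
    _ = ∑' k, ∫⁻ y in φ '' s k, g y := by
        congr 1
        ext k
        rw [lintegral_image_eq_lintegral_abs_det_fderiv_mul volume (hs1 k)
          (fun x hx => (ht4 k x (hst k hx)).mono (hst k)) (hinj.mono (hsΩ k))]
    _ = ∫⁻ y in ⋃ k, φ '' s k, g y :=
        (lintegral_iUnion (fun k => (hs1 k).image_of_continuousOn_injOn (hc.mono (hsΩ k))
          (hinj.mono (hsΩ k))) hdisj _).symm
    _ ≤ ∫⁻ y in Ω', g y :=
        lintegral_mono_set (iUnion_subset fun k => (hmaps.mono_left (hsΩ k)).image_subset)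

end ChangeOfVariables

/-- A map whose weighted change of variables inequality has an almost everywhere positive weight
pulls null sets back to null sets. -/
theorem map_absolutelyContinuous_of_lintegral_mul_comp_le {α β : Type*} [MeasurableSpace α]
    [MeasurableSpace β] {μ : Measure α} {ν : Measure β} {φ : α → β} {J : α → ℝ≥0∞}
    (hφ : AEMeasurable φ μ) (hJ : AEMeasurable J μ) (hJ0 : ∀ᵐ x ∂μ, J x ≠ 0)
    (h : ∀ g : β → ℝ≥0∞, ∫⁻ x, J x * g (φ x) ∂μ ≤ ∫⁻ y, g y ∂ν) : μ.map φ ≪ ν := by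
  refine Measure.AbsolutelyContinuous.mk fun S hS hνS => ?_
  have h1 := h (S.indicator 1)
  rw [lintegral_indicator_one hS, hνS, nonpos_iff_eq_zero] at h1
  have h2 := (lintegral_eq_zero_iff'
    (hJ.mul ((measurable_one.indicator hS).comp_aemeasurable hφ))).1 h1
  rw [Measure.map_apply_of_aemeasurable hφ hS]
  refine measure_eq_zero_iff_ae_notMem.2 ?_
  filter_upwards [h2, hJ0] with x hx hx0 hxS
  have hxS' : φ x ∈ S := hxS
  simp [indicator_of_mem hxS', hx0] at hx

/-- Hölder's inequality for a composition, with a weight satisfying a change of variables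
inequality. -/
theorem lintegral_comp_rpow_le {α β : Type*} [MeasurableSpace α]
    [MeasurableSpace β] {μ : Measure α} {ν : Measure β} {φ : α → β} {J : α → ℝ≥0∞}
    (hJ : AEMeasurable J μ) (hJ0 : ∀ᵐ x ∂μ, J x ≠ 0) (hJt : ∀ x, J x ≠ ⊤)
    (h : ∀ g : β → ℝ≥0∞, ∫⁻ x, J x * g (φ x) ∂μ ≤ ∫⁻ y, g y ∂ν)
    {g : β → ℝ≥0∞} (hg : AEMeasurable (fun x => g (φ x)) μ) {b P Q : ℝ} (hb : 0 < b) (hP : 0 < P)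
    (hQ : Q = b * P / (b + 1)) :
    (∫⁻ x, g (φ x) ^ Q ∂μ) ^ (1 / Q) ≤
      ((∫⁻ x, J x ^ (-b) ∂μ) ^ (1 / b)) ^ (1 / P) * (∫⁻ y, g y ^ P ∂ν) ^ (1 / P) := by
  have hQ0 : 0 < Q := by rw [hQ]; positivity
  have hpt : ∀ᵐ x ∂μ, g (φ x) ^ Q =
      (J x * g (φ x) ^ P) ^ (b / (b + 1)) * (J x ^ (-b)) ^ (1 / (b + 1)) := by
    filter_upwards [hJ0] with x hx
    rw [ENNReal.mul_rpow_of_nonneg _ _ (by positivity), ← ENNReal.rpow_mul, ← ENNReal.rpow_mul,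
      mul_right_comm, ← ENNReal.rpow_add _ _ hx (hJt x)]
    have e1 : b / (b + 1) + -b * (1 / (b + 1)) = 0 := by field_simp; ring
    have e2 : P * (b / (b + 1)) = Q := by rw [hQ]; ring
    rw [e1, e2, ENNReal.rpow_zero, one_mul]
  have hH := ENNReal.lintegral_mul_norm_pow_le (μ := μ) (hJ.mul (hg.pow_const P))
    (hJ.pow_const (-b)) (p := b / (b + 1)) (q := 1 / (b + 1)) (by positivity) (by positivity)
    (by field_simp)
  have hle : ∫⁻ x, g (φ x) ^ Q ∂μ ≤ (∫⁻ y, g y ^ P ∂ν) ^ (b / (b + 1)) *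
      (∫⁻ x, J x ^ (-b) ∂μ) ^ (1 / (b + 1)) := by
    rw [lintegral_congr_ae hpt]
    refine hH.trans ?_
    gcongr
    exact h fun y => g y ^ P
  calc (∫⁻ x, g (φ x) ^ Q ∂μ) ^ (1 / Q)
      ≤ ((∫⁻ y, g y ^ P ∂ν) ^ (b / (b + 1)) * (∫⁻ x, J x ^ (-b) ∂μ) ^ (1 / (b + 1))) ^ (1 / Q) :=
        by gcongr
    _ = _ := by
        rw [ENNReal.mul_rpow_of_nonneg _ _ (by positivity), ← ENNReal.rpow_mul,
          ← ENNReal.rpow_mul, ← ENNReal.rpow_mul, mul_comm]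
        have e1 : b / (b + 1) * (1 / Q) = 1 / P := by rw [hQ]; field_simp
        have e2 : 1 / (b + 1) * (1 / Q) = 1 / b * (1 / P) := by rw [hQ]; field_simp
        rw [e1, e2]

theorem ENNReal.toReal_eq_of_one_div_eq {p q : ℝ≥0∞} {b : ℝ} (hb : 0 < b) (hp : p ≠ 0)
    (hpt : p ≠ ⊤) (hq : 1 / q = 1 / p + 1 / ENNReal.ofReal b * (1 / p)) :
    q ≠ 0 ∧ q ≠ ⊤ ∧ q.toReal = b * p.toReal / (b + 1) := by
  have hp' : p⁻¹ ≠ ⊤ := ENNReal.inv_ne_top.2 hp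
  have hb' : (ENNReal.ofReal b)⁻¹ ≠ ⊤ := ENNReal.inv_ne_top.2 (by simpa using hb)
  simp only [one_div] at hq
  have hP : 0 < p.toReal := ENNReal.toReal_pos hp hpt
  have hr := congrArg ENNReal.toReal hq
  rw [ENNReal.toReal_add hp' (ENNReal.mul_ne_top hb' hp'), ENNReal.toReal_mul,
    ENNReal.toReal_inv, ENNReal.toReal_inv, ENNReal.toReal_inv, ENNReal.toReal_ofReal hb.le] at hr
  refine ⟨?_, ?_, ?_⟩
  · refine ENNReal.inv_ne_top.1 ?_
    rw [hq]
    exact ENNReal.add_ne_top.2 ⟨hp', ENNReal.mul_ne_top hb' hp'⟩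
  · rintro rfl
    have h0 : (⊤ : ℝ≥0∞).toReal⁻¹ = 0 := by simp
    rw [h0] at hr
    have : 0 < p.toReal⁻¹ + b⁻¹ * p.toReal⁻¹ := by positivity
    linarith
  · rw [← inv_inv q.toReal, hr]
    field_simp

theorem mainTheorem3 {n : ℕ} (hn : 2 ≤ n) {K : ℝ} (hK : 1 ≤ K)
    {Ω Ω' : Set (EuclideanSpace ℝ (Fin n))}
    (hΩ : IsEuclideanDomain Ω) (hΩ' : IsEuclideanDomain Ω')
    {φ : EuclideanSpace ℝ (Fin n) → EuclideanSpace ℝ (Fin n)}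
    (hφ : IsQuasiconformal K φ Ω Ω')
    {b C_b : ℝ} (hb : 0 < b)
    (hC : (∫⁻ x in Ω, ENNReal.ofReal |weakJacobian φ Ω x| ^ (-b)) ^ (1 / b) ≤ ENNReal.ofReal C_b)
    {p q : ℝ≥0∞} (hp : 0 < p) (hq : 1 / q = 1 / p + 1 / ENNReal.ofReal b * (1 / p))
    {f : EuclideanSpace ℝ (Fin n) → ℝ} (hf : MemLp f p (volume.restrict Ω')) :
    MemLp (f ∘ φ) q (volume.restrict Ω) ∧
      eLpNorm (f ∘ φ) q (volume.restrict Ω) ≤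
        ENNReal.ofReal C_b ^ (1 / p).toReal * eLpNorm f p (volume.restrict Ω') := by
  have hW := hφ.memW11loc.hasWeakFDerivOn
  obtain ⟨e, rfl, rfl, heq⟩ := hφ.homeomorph
  have hc : ContinuousOn φ e.source := e.continuousOn.congr heq
  have harea := hW.lintegral_abs_det_mul_comp_le hΩ.isOpen hc (e.injOn.congr heq.symm)
    (e.mapsTo.congr heq.symm)
  set J : EuclideanSpace ℝ (Fin n) → ℝ≥0∞ := fun x => ENNReal.ofReal |weakJacobian φ e.source x|
  have hJ : AEMeasurable J (volume.restrict e.source) := by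
    have h1 := hW.locallyIntegrableOn_deriv.aestronglyMeasurable
    exact (ContinuousLinearMap.continuous_det.comp_aestronglyMeasurable
      h1).aemeasurable.abs.ennreal_ofReal
  have hJ0 : ∀ᵐ x ∂(volume.restrict e.source), J x ≠ 0 := by
    have hfin : ∫⁻ x in e.source, J x ^ (-b) ≠ ⊤ := by
      intro htop
      rw [htop, ENNReal.top_rpow_of_pos (by positivity)] at hC
      exact ENNReal.ofReal_ne_top (top_le_iff.1 hC)
    filter_upwards [ae_lt_top' (hJ.pow_const (-b)) hfin] with x hx hx0
    rw [hx0, ENNReal.zero_rpow_of_neg (by linarith)] at hx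
    exact lt_irrefl _ hx
  have hφm : AEMeasurable φ (volume.restrict e.source) := hc.aemeasurable hΩ.isOpen.measurableSet
  have hac := map_absolutelyContinuous_of_lintegral_mul_comp_le hφm hJ hJ0 harea
  have hfm : AEStronglyMeasurable (f ∘ φ) (volume.restrict e.source) :=
    (hf.1.mono_ac hac).comp_aemeasurable hφm
  have hle : eLpNorm (f ∘ φ) q (volume.restrict e.source) ≤
      ENNReal.ofReal C_b ^ (1 / p).toReal * eLpNorm f p (volume.restrict e.target) := by
    rcases eq_or_ne p ⊤ with rfl | hpt
    · have hqt : q = ⊤ := by simpa using hq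
      rw [hqt, ← eLpNorm_map_measure (hf.1.mono_ac hac) hφm]
      simpa using eLpNormEssSup_mono_measure f hac
    · obtain ⟨hq0, hqt, hqr⟩ := ENNReal.toReal_eq_of_one_div_eq hb hp.ne' hpt hq
      rw [eLpNorm_eq_lintegral_rpow_enorm_toReal hq0 hqt,
        eLpNorm_eq_lintegral_rpow_enorm_toReal hp.ne' hpt]
      refine (lintegral_comp_rpow_le hJ hJ0 (fun x => ENNReal.ofReal_ne_top) harea
        (g := fun y => ‖f y‖ₑ) hfm.enorm hb (ENNReal.toReal_pos hp.ne' hpt) hqr).trans ?_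
      rw [one_div p, ENNReal.toReal_inv, ← one_div]
      gcongr
  refine ⟨⟨hfm, hle.trans_lt (ENNReal.mul_lt_top ?_ hf.2)⟩, hle⟩
  exact ENNReal.rpow_lt_top_of_nonneg ENNReal.toReal_nonneg ENNReal.ofReal_ne_top
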